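/- **Theorem 3.4.** Let $\Sigma^2$ be Hamilton's cigar, i.e. $\mathbb R^2$ with the metric $g_\Sigma=\dfrac{dx^2+dy^2}{1+x^2+y^2}$, and put $r=\sqrt{x^2+y^2}$, $\rho=\sinh^{-1}r$. Equip $\mathbb R\times\Sigma^2$, with coordinates $(s,x,y)$, with the product metric $g=ds^2+g_\Sigma$. In the coordinates $(s,\rho,\theta)$ with $x=\sinh\rho\cos\theta$, $y=\sinh\rho\sin\theta$ this metric is $$g=ds^2+d\rho^2+\tanh^2\!\rho\,d\theta^2 .$$ A *Ricci potential* of a Riemannian metric is a smooth function $f$ with $\mathrm{Ric}=\nabla\nabla f$, i.e. $R_{ij}=\nabla_i\nabla_j f$. A function $f$ has *linear growth* if there are a point $o$ and a constant $C\ge 0$ with $|f(p)|\le C\,(1+d_g(o,p))$ for all $p$, where $d_g$ is the Riemannian distance. Then the set of Ricci potentials with linear growth on $(\mathbb R\times\Sigma^2,g)$ is exactly the affine space $$\{\,c_1+c_2\,s+2\ln\cosh\rho \;:\; c_1,c_2\in\mathbb R\,\},$$ and $2\ln\cosh\rho$ is a Ricci potential of the cigar $(\Sigma^2,g_\Sigma)$.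 -/

import Mathlib

open scoped Manifold ContDiff NNReal

noncomputable section

namespace RicciSoliton

/-- The components `g i j` of a metric tensor on `ℝⁿ` in the standard global coordinates. -/
abbrev MetricField (n : ℕ) := (Fin n → ℝ) → Matrix (Fin n) (Fin n) ℝ

/-- The coordinate partial derivative `∂ᵢ f`. -/
def pd {n : ℕ} (i : Fin n) (f : (Fin n → ℝ) → ℝ) (p : Fin n → ℝ) : ℝ :=
  fderiv ℝ f p (Pi.single i 1)

/-- The value `g_p(v, w)` of the metric on two tangent vectors at `p`. -/
def metricInner {n : ℕ} (g : MetricField n) (p v w : Fin n → ℝ) : ℝ :=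
  ∑ i, ∑ j, g p i j * v i * w j

/-- Christoffel symbols `Γᵏᵢⱼ = ½ gᵏˡ (∂ᵢ gⱼₗ + ∂ⱼ gᵢₗ - ∂ₗ gᵢⱼ)` of the Levi-Civita connection. -/
def christoffel {n : ℕ} (g : MetricField n) (k i j : Fin n) (p : Fin n → ℝ) : ℝ :=
  (1 / 2) * ∑ l, (g p)⁻¹ k l *
    (pd i (fun q => g q j l) p + pd j (fun q => g q i l) p - pd l (fun q => g q i j) p)

/-- The components `Rˡₖᵢⱼ` of the curvature tensor, with
`R(∂ᵢ, ∂ⱼ)∂ₖ = ∇ᵢ∇ⱼ∂ₖ - ∇ⱼ∇ᵢ∂ₖ = Rˡₖᵢⱼ ∂ₗ`. -/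
def riemann {n : ℕ} (g : MetricField n) (l k i j : Fin n) (p : Fin n → ℝ) : ℝ :=
  pd i (christoffel g l j k) p - pd j (christoffel g l i k) p +
    ∑ m, (christoffel g l i m p * christoffel g m j k p -
      christoffel g l j m p * christoffel g m i k p)

/-- The Ricci tensor: `Ric(∂ⱼ, ∂ₖ)` is the trace of `X ↦ R(X, ∂ⱼ)∂ₖ`. -/
def ricci {n : ℕ} (g : MetricField n) (j k : Fin n) (p : Fin n → ℝ) : ℝ :=
  ∑ i, riemann g i k i j p

/-- The Hessian `∇ᵢ∇ⱼ f = ∂ᵢ∂ⱼ f - Γᵏᵢⱼ ∂ₖ f`. -/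
def hessian {n : ℕ} (g : MetricField n) (f : (Fin n → ℝ) → ℝ) (i j : Fin n)
    (p : Fin n → ℝ) : ℝ :=
  pd i (pd j f) p - ∑ k, christoffel g k i j p * pd k f p

/-- `f` is a Ricci potential of `g`: a smooth function with `Rᵢⱼ = ∇ᵢ∇ⱼ f`. -/
def IsRicciPotential {n : ℕ} (g : MetricField n) (f : (Fin n → ℝ) → ℝ) : Prop :=
  ContDiff ℝ ∞ f ∧ ∀ (p : Fin n → ℝ) (i j : Fin n), ricci g i j p = hessian g f i j p

/-- The Riemannian distance of `g`: the infimum of the `g`-lengths of `C¹` paths, where a tangent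
vector `v` at `p` has length `√(g_p(v, v))`. -/
def metricEDist {n : ℕ} (g : MetricField n) (p q : Fin n → ℝ) : ENNReal :=
  letI : ∀ x : Fin n → ℝ, ENorm (TangentSpace 𝓘(ℝ, Fin n → ℝ) x) :=
    fun x => ⟨fun v => ENNReal.ofReal (Real.sqrt (metricInner g x v v))⟩
  Manifold.riemannianEDist 𝓘(ℝ, Fin n → ℝ) p q

/-- `f` has (at most) linear growth: `|f p| ≤ C (1 + d(o, p))` for some base point `o` and some
constant `C`. -/
def HasLinearGrowth {n : ℕ} (g : MetricField n) (f : (Fin n → ℝ) → ℝ) : Prop :=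
  ∃ (o : Fin n → ℝ) (C : ℝ≥0), ∀ p, ENNReal.ofReal |f p| ≤ C * (1 + metricEDist g o p)

/-- The Riemannian product of the line `(ℝ, ds²)` with `(ℝⁿ, g)`; `s` is the coordinate `p 0`. -/
def lineProduct {n : ℕ} (g : MetricField n) : MetricField (n + 1) := fun p =>
  Matrix.of (Matrix.vecCons (Matrix.vecCons 1 0)
    fun i => Matrix.vecCons 0 (g (Matrix.vecTail p) i))

/-- Hamilton's cigar metric `(dx² + dy²) / (1 + x² + y²)` on `ℝ²`. -/
def cigarMetric : MetricField 2 := fun p =>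
  (1 + p 0 ^ 2 + p 1 ^ 2)⁻¹ • (1 : Matrix (Fin 2) (Fin 2) ℝ)

/-- The radial coordinate `ρ = sinh⁻¹ r`, `r = √(x² + y²)`, of the cigar. -/
def cigarRho (p : Fin 2 → ℝ) : ℝ := Real.arsinh (Real.sqrt (p 0 ^ 2 + p 1 ^ 2))

/-- The change of coordinates `(s, ρ, θ) ↦ (s, x, y) = (s, sinh ρ cos θ, sinh ρ sin θ)`. -/
def polarMap (q : Fin 3 → ℝ) : Fin 3 → ℝ :=
  ![q 0, Real.sinh (q 1) * Real.cos (q 2), Real.sinh (q 1) * Real.sin (q 2)]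

end RicciSoliton

end

/-! With `u = 1 + x² + y²` one has `2 ln cosh ρ = log u`, and on the cigar both `Ric` and `∇∇ log u`
equal `2u⁻² (dx² + dy²)`, so `log u` is a Ricci potential; on the product both tensors vanish in the
`s` direction.

Two Ricci potentials differ by a function `F` with `∇∇F = 0`. Its gradient is parallel, hence
annihilated by the curvature; since the cigar has Gaussian curvature `2/u ≠ 0`, the `x` and `y`
derivatives of `F` vanish, and `F` is affine in `s` (`exists_affine_of_hessian_eq_zero`). Conversely
each `c₁ + c₂ s + log u` has bounded gradient, so it is Lipschitz for the Riemannian distance and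
grows at most linearly (`enorm_sub_le_mul_metricEDist`).

Cigar and product are treated together as `warpMetric a`, where `a i ∈ {0, 1}` marks the cigar
directions. -/

namespace RicciSoliton

/-! ### Calculus of coordinate partial derivatives. -/

section PartialDerivatives

variable {n : ℕ} {f h : (Fin n → ℝ) → ℝ} {p : Fin n → ℝ}

lemma pd_const (i : Fin n) (c : ℝ) : pd i (fun _ => c) p = 0 := by
  simp [pd]

lemma pd_coord (i j : Fin n) : pd i (fun q => q j) p = if j = i then 1 else 0 := by
  have : HasFDerivAt (fun q : Fin n → ℝ => q j)
      (ContinuousLinearMap.proj (R := ℝ) (φ := fun _ => ℝ) j) p := hasFDerivAt_apply j p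
  simp [pd, this.fderiv, Pi.single_apply]

lemma pd_add (i : Fin n) (hf : DifferentiableAt ℝ f p) (hh : DifferentiableAt ℝ h p) :
    pd i (fun q => f q + h q) p = pd i f p + pd i h p := by
  simp [pd, fderiv_fun_add hf hh]

lemma pd_sub (i : Fin n) (hf : DifferentiableAt ℝ f p) (hh : DifferentiableAt ℝ h p) :
    pd i (fun q => f q - h q) p = pd i f p - pd i h p := by
  simp [pd, fderiv_fun_sub hf hh]

lemma pd_neg (i : Fin n) : pd i (fun q => -f q) p = -pd i f p := by
  simp [pd, fderiv_fun_neg]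

lemma pd_mul (i : Fin n) (hf : DifferentiableAt ℝ f p) (hh : DifferentiableAt ℝ h p) :
    pd i (fun q => f q * h q) p = f p * pd i h p + h p * pd i f p := by
  simp [pd, fderiv_fun_mul hf hh]

lemma pd_inv (i : Fin n) (hf : DifferentiableAt ℝ f p) (h0 : f p ≠ 0) :
    pd i (fun q => (f q)⁻¹) p = -pd i f p / f p ^ 2 := by
  have := (hasDerivAt_inv h0).comp_hasFDerivAt p hf.hasFDerivAt
  have h2 : HasFDerivAt (fun q => (f q)⁻¹) (-(f p ^ 2)⁻¹ • fderiv ℝ f p) p := this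
  simp [pd, h2.fderiv]
  ring

lemma pd_log (i : Fin n) (hf : DifferentiableAt ℝ f p) (h0 : f p ≠ 0) :
    pd i (fun q => Real.log (f q)) p = pd i f p / f p := by
  simp [pd, fderiv.log hf h0]
  ring

lemma pd_sum {ι : Type*} (s : Finset ι) (i : Fin n) {F : ι → (Fin n → ℝ) → ℝ}
    (hF : ∀ j ∈ s, DifferentiableAt ℝ (F j) p) :
    pd i (fun q => ∑ j ∈ s, F j q) p = ∑ j ∈ s, pd i (F j) p := by
  simp [pd, fderiv_fun_sum hF]

lemma contDiff_pd (i : Fin n) (hf : ContDiff ℝ ∞ f) : ContDiff ℝ ∞ (pd i f) := by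
  unfold pd
  exact (hf.fderiv_right (m := ∞) (by simp)).clm_apply contDiff_const

lemma pd_comm (i j : Fin n) (hf : ContDiff ℝ ∞ f) : pd i (pd j f) p = pd j (pd i f) p := by
  have hs : IsSymmSndFDerivAt ℝ f p :=
    hf.contDiffAt.isSymmSndFDerivAt (by simp; exact WithTop.coe_le_coe.2 (le_top : (2 : ℕ∞) ≤ ⊤))
  have hd : DifferentiableAt ℝ (fderiv ℝ f) p :=
    (hf.fderiv_right (m := ∞) (by simp)).differentiable (by simp) p
  have key : ∀ k l : Fin n, pd k (pd l f) p
      = fderiv ℝ (fderiv ℝ f) p (Pi.single k 1) (Pi.single l 1) := by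
    intro k l
    have := hd.hasFDerivAt.clm_apply (hasFDerivAt_const (Pi.single l (1:ℝ) : Fin n → ℝ) p)
    change fderiv ℝ (fun q => fderiv ℝ f q (Pi.single l 1)) p (Pi.single k 1) = _
    rw [this.fderiv]
    simp
  rw [key, key, hs]

lemma fderiv_apply_eq_sum_pd (v : Fin n → ℝ) : fderiv ℝ f p v = ∑ i, v i * pd i f p := by
  conv_lhs => rw [← Finset.univ_sum_single v]
  rw [map_sum]
  refine Finset.sum_congr rfl fun i _ => ?_
  have : (Pi.single i (v i) : Fin n → ℝ) = v i • Pi.single i 1 := by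
    rw [← Pi.single_smul]; simp
  rw [this, map_smul, smul_eq_mul, pd]

lemma eq_of_pd_eq_zero (hf : Differentiable ℝ f) (h0 : ∀ q i, pd i f q = 0)
    (p q : Fin n → ℝ) : f p = f q := by
  refine is_const_of_fderiv_eq_zero hf (fun x => ?_) p q
  ext v
  simp [fderiv_apply_eq_sum_pd, h0]

end PartialDerivatives

/-- The function `1 + |x|²`, where `x` consists of the coordinates selected by `a`. -/
noncomputable def warp {n : ℕ} (a p : Fin n → ℝ) : ℝ := 1 + ∑ i, a i * p i ^ 2

/-- The diagonal metric which is `dxᵢ² / (1 + |x|²)` in the directions with `a i = 1` and `dxᵢ²` in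
those with `a i = 0`. -/
noncomputable def warpMetric {n : ℕ} (a : Fin n → ℝ) : MetricField n := fun p =>
  Matrix.diagonal fun i => 1 - a i + a i * (warp a p)⁻¹

lemma cigarMetric_eq : cigarMetric = warpMetric ![1, 1] := by
  funext p
  ext i j
  fin_cases i <;> fin_cases j <;>
    simp [cigarMetric, warpMetric, warp, Fin.sum_univ_two, Matrix.diagonal, add_assoc]

lemma lineProduct_cigarMetric_eq : lineProduct cigarMetric = warpMetric ![0, 1, 1] := by
  funext p
  ext i j
  fin_cases i <;> fin_cases j <;>
    simp [lineProduct, cigarMetric, warpMetric, warp, Fin.sum_univ_three, Matrix.diagonal,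
      Matrix.vecTail, add_assoc]

/-! ### Christoffel symbols of the warped metrics and derivatives of `log u`. -/

section Warp

variable {n : ℕ} {a : Fin n → ℝ}

lemma warp_pos (ha : ∀ i, a i = 0 ∨ a i = 1) (p : Fin n → ℝ) : 0 < warp a p := by
  have : 0 ≤ ∑ i, a i * p i ^ 2 := Finset.sum_nonneg fun i _ =>
    mul_nonneg (by rcases ha i with h | h <;> simp [h]) (sq_nonneg _)
  unfold warp
  linarith

@[fun_prop]
lemma contDiff_warp {m : WithTop ℕ∞} : ContDiff ℝ m (warp a) := by
  unfold warp
  fun_prop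

@[fun_prop]
lemma differentiableAt_warp (p : Fin n → ℝ) : DifferentiableAt ℝ (warp a) p :=
  (contDiff_warp (m := 1)).differentiable (by simp) p

lemma pd_warp (i : Fin n) (p : Fin n → ℝ) : pd i (warp a) p = 2 * a i * p i := by
  unfold warp
  rw [pd_add i (by fun_prop) (by fun_prop), pd_const, pd_sum _ _ (by intros; fun_prop), zero_add,
    Finset.sum_eq_single i]
  · simp only [pow_two]
    rw [pd_mul i (by fun_prop) (by fun_prop), pd_mul i (by fun_prop) (by fun_prop), pd_const,
      pd_coord]
    simp
    ring
  · intro j _ hj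
    simp only [pow_two]
    rw [pd_mul i (by fun_prop) (by fun_prop), pd_mul i (by fun_prop) (by fun_prop), pd_const,
      pd_coord]
    simp [hj]
  · simp

lemma warpMetric_inv (ha : ∀ i, a i = 0 ∨ a i = 1) (p : Fin n → ℝ) :
    (warpMetric a p)⁻¹ = Matrix.diagonal fun i => 1 - a i + a i * warp a p := by
  refine Matrix.inv_eq_right_inv ?_
  rw [warpMetric, Matrix.diagonal_mul_diagonal, ← Matrix.diagonal_one]
  congr 1
  funext i
  have := (warp_pos ha p).ne'
  rcases ha i with h | h <;> simp [h, this]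

lemma pd_warpMetric (ha : ∀ i, a i = 0 ∨ a i = 1) (i j k : Fin n) (p : Fin n → ℝ) :
    pd i (fun q => warpMetric a q j k) p =
      if j = k then -(2 * a i * a j * p i) / warp a p ^ 2 else 0 := by
  by_cases h : j = k
  · subst h
    simp only [warpMetric, Matrix.diagonal_apply_eq, if_true]
    have h0 := (warp_pos ha p).ne'
    have hd : DifferentiableAt ℝ (fun q => (warp a q)⁻¹) p := (differentiableAt_warp p).inv h0
    rw [pd_add i (by fun_prop) (by fun_prop), pd_const, pd_mul i (by fun_prop) hd, pd_const,
      pd_inv i (by fun_prop) h0, pd_warp]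
    ring
  · simp [warpMetric, h, pd_const]

/-- The numerators of the Christoffel symbols of `warpMetric a`. -/
noncomputable def warpSymbol (a : Fin n → ℝ) (k i j : Fin n) (p : Fin n → ℝ) : ℝ :=
  a i * a j * a k *
    ((if i = k then p j else 0) + (if j = k then p i else 0) - if i = j then p k else 0)

lemma christoffel_warpMetric (ha : ∀ i, a i = 0 ∨ a i = 1) (k i j : Fin n) :
    christoffel (warpMetric a) k i j = fun p => -(warpSymbol a k i j p * (warp a p)⁻¹) := by
  funext p
  have h0 := (warp_pos ha p).ne'
  simp only [christoffel, warpMetric_inv ha, pd_warpMetric ha, warpSymbol]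
  rw [Finset.sum_eq_single k (by intro l _ hl; simp [Matrix.diagonal_apply_ne _ hl.symm])
    (by simp), Matrix.diagonal_apply_eq]
  rcases ha i with hi | hi <;> rcases ha j with hj | hj <;> rcases ha k with hk | hk <;>
    by_cases h1 : i = k <;> by_cases h2 : j = k <;> by_cases h3 : i = j <;>
    simp_all <;> try (field_simp; try ring)

/-- The symbol is linear in the point, so its derivative along a basis vector is its value there. -/
lemma pd_warpSymbol (l k i j : Fin n) (p : Fin n → ℝ) :
    pd l (warpSymbol a k i j) p = warpSymbol a k i j (Pi.single l 1) := by
  have : IsLinearMap ℝ (warpSymbol a k i j) :=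
    ⟨fun p q => by simp only [warpSymbol, Pi.add_apply]; split_ifs <;> ring,
      fun c p => by simp only [warpSymbol, Pi.smul_apply, smul_eq_mul]; split_ifs <;> ring⟩
  have h := (LinearMap.toContinuousLinearMap (IsLinearMap.mk' _ this)).hasFDerivAt (x := p)
  have h2 : HasFDerivAt (warpSymbol a k i j)
      (LinearMap.toContinuousLinearMap (IsLinearMap.mk' _ this)) p := h
  simp [pd, h2.fderiv]

@[fun_prop]
lemma differentiableAt_warpSymbol (k i j : Fin n) (p : Fin n → ℝ) :
    DifferentiableAt ℝ (warpSymbol a k i j) p := by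
  unfold warpSymbol
  split_ifs <;> fun_prop

lemma pd_christoffel_warpMetric (ha : ∀ i, a i = 0 ∨ a i = 1) (l k i j : Fin n)
    (p : Fin n → ℝ) :
    pd l (christoffel (warpMetric a) k i j) p =
      2 * a l * p l * warpSymbol a k i j p / warp a p ^ 2 -
        warpSymbol a k i j (Pi.single l 1) / warp a p := by
  have h0 := (warp_pos ha p).ne'
  have hd : DifferentiableAt ℝ (fun q => (warp a q)⁻¹) p := (differentiableAt_warp p).inv h0
  rw [christoffel_warpMetric ha, pd_neg, pd_mul l (by fun_prop) hd, pd_inv l (by fun_prop) h0,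
    pd_warp, pd_warpSymbol]
  ring

lemma pd_log_warp (ha : ∀ i, a i = 0 ∨ a i = 1) (j : Fin n) :
    pd j (fun q => Real.log (warp a q)) = fun p => 2 * a j * p j * (warp a p)⁻¹ := by
  funext p
  rw [pd_log j (by fun_prop) (warp_pos ha p).ne', pd_warp]
  rfl

lemma pd_pd_log_warp (ha : ∀ i, a i = 0 ∨ a i = 1) (i j : Fin n) (p : Fin n → ℝ) :
    pd i (pd j fun q => Real.log (warp a q)) p =
      (if j = i then 2 * a j / warp a p else 0) -
        4 * a i * a j * p i * p j / warp a p ^ 2 := by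
  have h0 := (warp_pos ha p).ne'
  have hd : DifferentiableAt ℝ (fun q => (warp a q)⁻¹) p := (differentiableAt_warp p).inv h0
  rw [pd_log_warp ha, pd_mul i (by fun_prop) hd, pd_mul i (by fun_prop) (by fun_prop), pd_const,
    pd_coord, pd_inv i (by fun_prop) h0, pd_warp]
  split_ifs <;> ring

lemma contDiff_log_warp (ha : ∀ i, a i = 0 ∨ a i = 1) :
    ContDiff ℝ ∞ fun q => Real.log (warp a q) :=
  contDiff_warp.log fun p => (warp_pos ha p).ne'

end Warp

/-! ### Ricci potentials and functions with vanishing Hessian. -/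

lemma isRicciPotential_log_warp_two :
    IsRicciPotential (warpMetric ![1, 1]) fun q => Real.log (warp ![1, 1] q) := by
  have ha : ∀ i, (![1, 1] : Fin 2 → ℝ) i = 0 ∨ (![1, 1] : Fin 2 → ℝ) i = 1 := by
    simp [Fin.forall_fin_succ]
  refine ⟨contDiff_log_warp ha, fun p i j => ?_⟩
  have h0 := (warp_pos ha p).ne'
  have hu : warp ![1, 1] p = 1 + p 0 ^ 2 + p 1 ^ 2 := by
    simp [warp, Fin.sum_univ_two, add_assoc]
  simp only [ricci, riemann, hessian, pd_christoffel_warpMetric ha, pd_pd_log_warp ha,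
    Fin.sum_univ_two]
  simp only [pd_log_warp ha, christoffel_warpMetric ha]
  rw [hu] at h0
  fin_cases i <;> fin_cases j <;> simp [warpSymbol, hu] <;> field_simp <;> ring

lemma isRicciPotential_log_warp_three :
    IsRicciPotential (warpMetric ![0, 1, 1]) fun q => Real.log (warp ![0, 1, 1] q) := by
  have ha : ∀ i, (![0, 1, 1] : Fin 3 → ℝ) i = 0 ∨ (![0, 1, 1] : Fin 3 → ℝ) i = 1 := by
    simp [Fin.forall_fin_succ]
  refine ⟨contDiff_log_warp ha, fun p i j => ?_⟩
  have h0 := (warp_pos ha p).ne'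
  have hu : warp ![0, 1, 1] p = 1 + p 1 ^ 2 + p 2 ^ 2 := by
    simp [warp, Fin.sum_univ_three, add_assoc]
  simp only [ricci, riemann, hessian, pd_christoffel_warpMetric ha, pd_pd_log_warp ha,
    Fin.sum_univ_three]
  simp only [pd_log_warp ha, christoffel_warpMetric ha]
  rw [hu] at h0
  fin_cases i <;> fin_cases j <;> simp [warpSymbol, hu] <;> field_simp <;> ring

lemma hessian_sub {n : ℕ} {g : MetricField n} {f h : (Fin n → ℝ) → ℝ} (hf : ContDiff ℝ ∞ f)
    (hh : ContDiff ℝ ∞ h) (i j : Fin n) (p : Fin n → ℝ) :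
    hessian g (fun q => f q - h q) i j p = hessian g f i j p - hessian g h i j p := by
  have h1 : ∀ k, pd k (fun q => f q - h q) = fun q => pd k f q - pd k h q := fun k =>
    funext fun q => pd_sub k (hf.differentiable (by simp) q) (hh.differentiable (by simp) q)
  simp only [hessian, h1]
  rw [pd_sub i ((contDiff_pd j hf).differentiable (by simp) p)
    ((contDiff_pd j hh).differentiable (by simp) p)]
  simp only [mul_sub, Finset.sum_sub_distrib]
  ring

/-- Affine functions of the line coordinate have vanishing Hessian. -/
lemma hessian_affine (c₁ c₂ : ℝ) (i j : Fin 3) (p : Fin 3 → ℝ) :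
    hessian (warpMetric ![0, 1, 1]) (fun q => c₁ + c₂ * q 0) i j p = 0 := by
  have ha : ∀ i, (![0, 1, 1] : Fin 3 → ℝ) i = 0 ∨ (![0, 1, 1] : Fin 3 → ℝ) i = 1 := by
    simp [Fin.forall_fin_succ]
  have h1 : ∀ k : Fin 3, pd k (fun q : Fin 3 → ℝ => c₁ + c₂ * q 0) =
      fun _ => if k = 0 then c₂ else 0 := by
    intro k
    funext q
    rw [pd_add k (by fun_prop) (by fun_prop), pd_const, pd_mul k (by fun_prop) (by fun_prop),
      pd_const, pd_coord]
    by_cases h : k = 0 <;> simp [h, eq_comm]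
  simp only [hessian, h1, pd_const, christoffel_warpMetric ha]
  simp [warpSymbol]

/-- A function with vanishing Hessian on the product of the line and the cigar is an affine
function of the line coordinate. -/
lemma exists_affine_of_hessian_eq_zero {F : (Fin 3 → ℝ) → ℝ} (hF : ContDiff ℝ ∞ F)
    (h : ∀ p i j, hessian (warpMetric ![0, 1, 1]) F i j p = 0) :
    ∃ c₁ c₂ : ℝ, F = fun p => c₁ + c₂ * p 0 := by
  have ha : ∀ i, (![0, 1, 1] : Fin 3 → ℝ) i = 0 ∨ (![0, 1, 1] : Fin 3 → ℝ) i = 1 := by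
    simp [Fin.forall_fin_succ]
  have hu : ∀ p, warp ![0, 1, 1] p = 1 + p 1 ^ 2 + p 2 ^ 2 := fun p => by
    simp [warp, Fin.sum_univ_three, add_assoc]
  -- `∇∇F = 0` is a first-order linear system for the partials of `F`; its integrability conditions
  -- are exploited below.
  have hess : ∀ i j, pd i (pd j F) = fun p =>
      -((∑ k, warpSymbol ![0, 1, 1] k i j p * pd k F p) * (warp ![0, 1, 1] p)⁻¹) := by
    intro i j
    funext p
    have := h p i j
    simp only [hessian, christoffel_warpMetric ha, sub_eq_zero] at this
    rw [this, Finset.sum_mul, ← Finset.sum_neg_distrib]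
    exact Finset.sum_congr rfl fun k _ => by ring
  have hG : ∀ k p, DifferentiableAt ℝ (pd k F) p := fun k p =>
    (contDiff_pd k hF).differentiable (by simp) p
  have e11 : pd 1 (pd 1 F) = fun p =>
      (p 2 * pd 2 F p - p 1 * pd 1 F p) * (warp ![0, 1, 1] p)⁻¹ := by
    rw [hess]; funext p; simp [Fin.sum_univ_three, warpSymbol]; ring
  have e12 : pd 1 (pd 2 F) = fun p =>
      (-(p 2 * pd 1 F p) - p 1 * pd 2 F p) * (warp ![0, 1, 1] p)⁻¹ := by
    rw [hess]; funext p; simp [Fin.sum_univ_three, warpSymbol]; ring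
  have e21 : pd 2 (pd 1 F) = fun p =>
      (-(p 2 * pd 1 F p) - p 1 * pd 2 F p) * (warp ![0, 1, 1] p)⁻¹ := by
    rw [hess]; funext p; simp [Fin.sum_univ_three, warpSymbol]; ring
  have e22 : pd 2 (pd 2 F) = fun p =>
      (p 1 * pd 1 F p - p 2 * pd 2 F p) * (warp ![0, 1, 1] p)⁻¹ := by
    rw [hess]; funext p; simp [Fin.sum_univ_three, warpSymbol]; ring
  have hpd : ∀ (i : Fin 3) (N : (Fin 3 → ℝ) → ℝ) (p : Fin 3 → ℝ), DifferentiableAt ℝ N p →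
      pd i (fun q => N q * (warp ![0, 1, 1] q)⁻¹) p =
        N p * (-(2 * (![0, 1, 1] : Fin 3 → ℝ) i * p i) / warp ![0, 1, 1] p ^ 2) +
          (warp ![0, 1, 1] p)⁻¹ * pd i N p := by
    intro i N p hN
    have h0 := (warp_pos ha p).ne'
    have hw : DifferentiableAt ℝ (fun q => (warp ![0, 1, 1] q)⁻¹) p :=
      (differentiableAt_warp p).inv h0
    rw [pd_mul i hN hw, pd_inv i (by fun_prop) h0, pd_warp]
  have hN1 : ∀ (i : Fin 3) (p : Fin 3 → ℝ), pd i (fun q => -(q 2 * pd 1 F q) - q 1 * pd 2 F q) p =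
      -(p 2 * pd i (pd 1 F) p + pd 1 F p * (if (2 : Fin 3) = i then 1 else 0)) -
        (p 1 * pd i (pd 2 F) p + pd 2 F p * (if (1 : Fin 3) = i then 1 else 0)) := by
    intro i p
    have := hG 1 p
    have := hG 2 p
    rw [pd_sub i (by fun_prop) (by fun_prop), pd_neg, pd_mul i (by fun_prop) (by fun_prop),
      pd_mul i (by fun_prop) (by fun_prop), pd_coord, pd_coord]
  have hN2 : ∀ (i j k : Fin 3) (p : Fin 3 → ℝ), pd i (fun q => q j * pd j F q - q k * pd k F q) p =
      (p j * pd i (pd j F) p + pd j F p * (if j = i then 1 else 0)) -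
        (p k * pd i (pd k F) p + pd k F p * (if k = i then 1 else 0)) := by
    intro i j k p
    have := hG j p
    have := hG k p
    rw [pd_sub i (by fun_prop) (by fun_prop), pd_mul i (by fun_prop) (by fun_prop),
      pd_mul i (by fun_prop) (by fun_prop), pd_coord, pd_coord]
  have hd1 : ∀ p, DifferentiableAt ℝ (fun q => -(q 2 * pd 1 F q) - q 1 * pd 2 F q) p := fun p => by
    have := hG 1 p
    have := hG 2 p
    fun_prop
  have hd2 : ∀ j k p, DifferentiableAt ℝ (fun q => q j * pd j F q - q k * pd k F q) p :=
    fun j k p => by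
      have := hG j p
      have := hG k p
      fun_prop
  have z2 : ∀ p, pd 2 F p = 0 := by
    intro p
    have h0 := (warp_pos ha p).ne'
    -- Equality of the mixed third derivatives, after substituting the system, collapses to `2u⁻²
    -- ∂₂F = 0`: the curvature applied to the gradient.
    have comm := pd_comm (p := p) 1 2 (contDiff_pd 1 hF)
    rw [e21, e11, hpd 1 _ _ (hd1 p), hpd 2 _ _ (hd2 2 1 p), hN1, hN2, e11, e12, e21, e22] at comm
    simp only [hu] at comm h0
    simp at comm
    field_simp at comm
    linarith
  have z1 : ∀ p, pd 1 F p = 0 := by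
    intro p
    have h0 := (warp_pos ha p).ne'
    have comm := pd_comm (p := p) 1 2 (contDiff_pd 2 hF)
    rw [e22, e12, hpd 2 _ _ (hd1 p), hpd 1 _ _ (hd2 1 2 p), hN1, hN2, e11, e12, e21, e22] at comm
    simp only [hu] at comm h0
    simp at comm
    field_simp at comm
    linarith
  have z0 : ∀ p, pd 0 F p = pd 0 F 0 := fun p => by
    refine eq_of_pd_eq_zero ((contDiff_pd 0 hF).differentiable (by simp)) (fun q i => ?_) p 0
    -- Every symbol with an index `0` carries the factor `a 0 = 0`, so all derivatives of `∂₀F`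
    -- vanish.
    rw [hess]
    simp [warpSymbol]
  refine ⟨F 0, pd 0 F 0, funext fun p => ?_⟩
  have hFd : Differentiable ℝ F := hF.differentiable (by simp)
  have := eq_of_pd_eq_zero (f := fun q => F q - pd 0 F 0 * q 0) (by fun_prop) (fun q i => ?_) p 0
  · simp at this
    linarith
  · rw [pd_sub i (hFd q) (by fun_prop), pd_mul i (by fun_prop) (by fun_prop), pd_const, pd_coord]
    fin_cases i
    · simp [z0 q]
    · simp [z1]
    · simp [z2]

lemma isRicciPotential_iff (f : (Fin 3 → ℝ) → ℝ) :
    IsRicciPotential (warpMetric ![0, 1, 1]) f ↔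
      ∃ c₁ c₂ : ℝ, f = fun p => c₁ + c₂ * p 0 + Real.log (warp ![0, 1, 1] p) := by
  obtain ⟨hs, hL⟩ := isRicciPotential_log_warp_three
  constructor
  · rintro ⟨hf, hR⟩
    obtain ⟨c₁, c₂, h⟩ := exists_affine_of_hessian_eq_zero (hf.sub hs) fun p i j => by
      have := hessian_sub (g := warpMetric ![0, 1, 1]) hf hs i j p
      rw [← hR, ← hL, sub_self] at this
      exact this
    refine ⟨c₁, c₂, funext fun p => ?_⟩
    have := congrFun h p
    simp at this
    linarith
  · rintro ⟨c₁, c₂, rfl⟩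
    have hA : ContDiff ℝ ∞ fun p : Fin 3 → ℝ => c₁ + c₂ * p 0 := by fun_prop
    have hf : ContDiff ℝ ∞ fun p : Fin 3 → ℝ =>
        c₁ + c₂ * p 0 + Real.log (warp ![0, 1, 1] p) := hA.add hs
    refine ⟨hf, fun p i j => ?_⟩
    have := hessian_sub (g := warpMetric ![0, 1, 1]) hf hA i j p
    simp only [add_sub_cancel_left] at this
    rw [hL, this, hessian_affine, sub_zero]

/-! ### Gradient bounds and linear growth. -/

/-- Integrating `|df(γ')| ≤ L |γ'|` along a nearly shortest path bounds the increment of `f` by `L`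
times its length. -/
lemma enorm_sub_le_mul_metricEDist {n : ℕ} {g : MetricField n} {f : (Fin n → ℝ) → ℝ}
    (hf : ContDiff ℝ 1 f) (L : ℝ≥0)
    (hL : ∀ p v, |fderiv ℝ f p v| ≤ L * Real.sqrt (metricInner g p v v)) (p q : Fin n → ℝ) :
    ‖f q - f p‖ₑ ≤ L * metricEDist g p q := by
  let _ : ∀ x : Fin n → ℝ, ENorm (TangentSpace 𝓘(ℝ, Fin n → ℝ) x) :=
    fun x => ⟨fun v => ENNReal.ofReal (Real.sqrt (metricInner g x v v))⟩
  have hL' : ∀ x v, ENNReal.ofReal |fderiv ℝ f x v| ≤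
      L * ENNReal.ofReal (Real.sqrt (metricInner g x v v)) := fun x v => by
    rw [← ENNReal.ofReal_coe_nnreal, ← ENNReal.ofReal_mul L.coe_nonneg]
    exact ENNReal.ofReal_le_ofReal (hL x v)
  have key : ∀ r : ENNReal, metricEDist g p q < r → ‖f q - f p‖ₑ ≤ L * r := by
    intro r hr
    obtain ⟨γ, h0, h1, hγ, hlen⟩ := Manifold.exists_lt_of_riemannianEDist_lt hr
    have hγ' : ContDiffOn ℝ 1 γ (Set.Icc 0 1) := contMDiffOn_iff_contDiffOn.1 hγ
    have hc : ContDiffOn ℝ 1 (f ∘ γ) (Set.Icc 0 1) := hf.comp_contDiffOn hγ'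
    have hle := enorm_sub_le_lintegral_derivWithin_Icc_of_contDiffOn_Icc hc zero_le_one
    simp only [Function.comp_apply, h0, h1] at hle
    refine hle.trans (le_trans ?_ (mul_le_mul_right hlen.le _))
    rw [Manifold.pathELength_eq_lintegral_mfderivWithin_Icc,
      ← MeasureTheory.lintegral_const_mul' _ _ ENNReal.coe_ne_top]
    refine MeasureTheory.setLIntegral_mono' measurableSet_Icc fun t ht => ?_
    have hu := uniqueDiffOn_Icc (zero_lt_one' ℝ) t ht
    have hd : derivWithin (f ∘ γ) (Set.Icc 0 1) t =
        fderiv ℝ f (γ t) (fderivWithin ℝ γ (Set.Icc 0 1) t 1) := by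
      rw [← fderivWithin_derivWithin, fderiv_comp_fderivWithin t
        (hf.differentiable one_ne_zero _) (hγ'.differentiableOn one_ne_zero t ht) hu]
      rfl
    rw [hd, mfderivWithin_eq_fderivWithin, Real.enorm_eq_ofReal_abs]
    exact hL' _ _
  rcases eq_or_ne (metricEDist g p q) ⊤ with h | h
  -- At infinite distance `L = 0` is special, because `0 * ⊤ = 0`; then `f` is constant.
  · rcases eq_or_ne L 0 with hL0 | hL0
    · have hz : ∀ x, fderiv ℝ f x = 0 := fun x => by
        ext v
        have := hL x v
        simp only [hL0, NNReal.coe_zero, zero_mul] at this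
        exact abs_nonpos_iff.1 this
      simp [is_const_of_fderiv_eq_zero (hf.differentiable one_ne_zero) hz q p]
    · rw [h, ENNReal.mul_top (by simpa using hL0)]
      exact le_top
  · refine ENNReal.le_of_forall_pos_le_add fun ε hε _ => ?_
    -- The excess length `ε / (L + 1)` costs at most `ε` after multiplication by `L`, even for `L =
    -- 0`.
    have hpos : 0 < ε / (L + 1) := by positivity
    refine (key (metricEDist g p q + (ε / (L + 1) : ℝ≥0))
      (ENNReal.lt_add_right h (by exact_mod_cast hpos.ne'))).trans ?_
    rw [mul_add]
    gcongr
    norm_cast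
    rw [← mul_div_assoc]
    refine div_le_of_le_mul₀ (by positivity) (by positivity) ?_
    rw [mul_comm]
    gcongr
    simp

lemma hasLinearGrowth_of_abs_fderiv_le {n : ℕ} {g : MetricField n} {f : (Fin n → ℝ) → ℝ}
    (hf : ContDiff ℝ 1 f) (L : ℝ≥0)
    (hL : ∀ p v, |fderiv ℝ f p v| ≤ L * Real.sqrt (metricInner g p v v)) :
    HasLinearGrowth g f := by
  refine ⟨0, ‖f 0‖₊ + L, fun p => ?_⟩
  rw [← Real.enorm_eq_ofReal_abs]
  calc ‖f p‖ₑ = ‖f 0 + (f p - f 0)‖ₑ := by congr 1; ring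
    _ ≤ ‖f 0‖ₑ + ‖f p - f 0‖ₑ := enorm_add_le _ _
    _ ≤ ‖f 0‖ₑ + L * metricEDist g 0 p := by
      gcongr
      exact enorm_sub_le_mul_metricEDist hf L hL 0 p
    _ ≤ (‖f 0‖ₑ + L) * (1 + metricEDist g 0 p) := by
      rw [add_mul]
      gcongr
      · exact le_mul_of_one_le_right (by simp) le_self_add
      · exact le_add_self
    _ = _ := by push_cast; rfl

lemma hasLinearGrowth_affine_add_log_warp (c₁ c₂ : ℝ) :
    HasLinearGrowth (warpMetric ![0, 1, 1])
      fun p => c₁ + c₂ * p 0 + Real.log (warp ![0, 1, 1] p) := by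
  have ha : ∀ i, (![0, 1, 1] : Fin 3 → ℝ) i = 0 ∨ (![0, 1, 1] : Fin 3 → ℝ) i = 1 := by
    simp [Fin.forall_fin_succ]
  have hs := contDiff_log_warp ha
  have hsm : ContDiff ℝ ∞ fun p : Fin 3 → ℝ =>
      c₁ + c₂ * p 0 + Real.log (warp ![0, 1, 1] p) := by
    have hA : ContDiff ℝ ∞ fun p : Fin 3 → ℝ => c₁ + c₂ * p 0 := by fun_prop
    exact hA.add hs
  -- `|c₂|` bounds the gradient of `c₂ s`, and `2` that of `log u`.
  refine hasLinearGrowth_of_abs_fderiv_le (hsm.of_le (WithTop.coe_le_coe.2 (le_top : (1 : ℕ∞) ≤ ⊤))) (‖c₂‖₊ + 2)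
    fun p v => ?_
  have hu0 := warp_pos ha p
  have hu : warp ![0, 1, 1] p = 1 + p 1 ^ 2 + p 2 ^ 2 := by
    simp [warp, Fin.sum_univ_three, add_assoc]
  have hpd : ∀ i, pd i (fun p : Fin 3 → ℝ => c₁ + c₂ * p 0 + Real.log (warp ![0, 1, 1] p)) p =
      c₂ * (if 0 = i then 1 else 0) +
        2 * (![0, 1, 1] : Fin 3 → ℝ) i * p i * (warp ![0, 1, 1] p)⁻¹ := by
    intro i
    rw [pd_add i (by fun_prop) (hs.differentiable (by simp) p), pd_log_warp ha,
      pd_add i (by fun_prop) (by fun_prop), pd_const, pd_mul i (by fun_prop) (by fun_prop),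
      pd_const, pd_coord]
    ring
  have hin : metricInner (warpMetric ![0, 1, 1]) p v v =
      v 0 ^ 2 + (v 1 ^ 2 + v 2 ^ 2) / warp ![0, 1, 1] p := by
    simp [metricInner, warpMetric, Fin.sum_univ_three, Matrix.diagonal]
    ring
  have hdf : fderiv ℝ (fun p : Fin 3 → ℝ => c₁ + c₂ * p 0 + Real.log (warp ![0, 1, 1] p)) p v =
      c₂ * v 0 + 2 * ((p 1 * v 1 + p 2 * v 2) / warp ![0, 1, 1] p) := by
    rw [fderiv_apply_eq_sum_pd]
    simp only [hpd, Fin.sum_univ_three]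
    simp
    ring
  rw [hin, hdf, NNReal.coe_add, add_mul]
  set u := warp ![0, 1, 1] p
  refine (abs_add_le _ _).trans (add_le_add ?_ ?_)
  · rw [abs_mul, coe_nnnorm, Real.norm_eq_abs]
    gcongr
    refine Real.abs_le_sqrt ?_
    have : 0 ≤ (v 1 ^ 2 + v 2 ^ 2) / u := by positivity
    linarith
  · rw [abs_mul, NNReal.coe_ofNat, abs_two]
    gcongr
    refine Real.abs_le_sqrt ?_
    have h1 : ((p 1 * v 1 + p 2 * v 2) / u) ^ 2 ≤ (v 1 ^ 2 + v 2 ^ 2) / u := by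
      rw [div_pow, div_le_div_iff₀ (by positivity) hu0]
      -- Cauchy–Schwarz together with `x² + y² ≤ u`.
      have h2 : (p 1 * v 1 + p 2 * v 2) ^ 2 ≤ (v 1 ^ 2 + v 2 ^ 2) * u := by
        rw [hu]
        nlinarith [sq_nonneg (p 1 * v 2 - p 2 * v 1), sq_nonneg (v 1), sq_nonneg (v 2)]
      nlinarith
    nlinarith [sq_nonneg (v 0)]

/-! ### The radial coordinate and the polar form of the metric. -/

lemma two_mul_log_cosh_cigarRho (p : Fin 2 → ℝ) :
    2 * Real.log (Real.cosh (cigarRho p)) = Real.log (1 + p 0 ^ 2 + p 1 ^ 2) := by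
  rw [cigarRho, Real.cosh_arsinh, Real.sq_sqrt (by positivity), Real.log_sqrt (by positivity),
    add_assoc]
  ring

lemma fderiv_polarMap (q v : Fin 3 → ℝ) :
    fderiv ℝ polarMap q v =
      ![v 0,
        Real.cosh (q 1) * Real.cos (q 2) * v 1 - Real.sinh (q 1) * Real.sin (q 2) * v 2,
        Real.cosh (q 1) * Real.sin (q 2) * v 1 + Real.sinh (q 1) * Real.cos (q 2) * v 2] := by
  have hq : ∀ i : Fin 3, HasFDerivAt (fun q : Fin 3 → ℝ => q i)
      (ContinuousLinearMap.proj (R := ℝ) (φ := fun _ : Fin 3 => ℝ) i) q :=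
    fun i => hasFDerivAt_apply i q
  have h1 := (hq 1).sinh.mul (hq 2).cos
  have h2 := (hq 1).sinh.mul (hq 2).sin
  have hd : DifferentiableAt ℝ polarMap q := by
    refine differentiableAt_pi.2 fun i => ?_
    fin_cases i
    exacts [(hq 0).differentiableAt, h1.differentiableAt, h2.differentiableAt]
  have h := hasFDerivAt_pi'.1 hd.hasFDerivAt
  have e0 := DFunLike.congr_fun ((h 0).unique (hq 0)) v
  have e1 := DFunLike.congr_fun ((h 1).unique h1) v
  have e2 := DFunLike.congr_fun ((h 2).unique h2) v
  simp at e0 e1 e2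
  funext i
  fin_cases i <;> simp [e0, e1, e2] <;> ring

lemma metricInner_polarMap (q v w : Fin 3 → ℝ) :
    metricInner (lineProduct cigarMetric) (polarMap q) (fderiv ℝ polarMap q v)
      (fderiv ℝ polarMap q w) =
        v 0 * w 0 + v 1 * w 1 + Real.tanh (q 1) ^ 2 * (v 2 * w 2) := by
  have hu : warp ![0, 1, 1] (polarMap q) = Real.cosh (q 1) ^ 2 := by
    simp [warp, Fin.sum_univ_three, polarMap]
    rw [Real.cosh_sq]
    linear_combination Real.sinh (q 1) ^ 2 * Real.sin_sq_add_cos_sq (q 2)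
  have h0 := (Real.cosh_pos (q 1)).ne'
  rw [lineProduct_cigarMetric_eq, fderiv_polarMap, fderiv_polarMap]
  simp [metricInner, warpMetric, Fin.sum_univ_three, Matrix.diagonal, hu]
  rw [Real.tanh_eq_sinh_div_cosh]
  field_simp
  linear_combination (Real.cosh (q 1) ^ 2 * v 1 * w 1 + Real.sinh (q 1) ^ 2 * v 2 * w 2) *
    Real.sin_sq_add_cos_sq (q 2)

lemma cigarRho_vecTail_polarMap (q : Fin 3 → ℝ) (hq : 0 ≤ q 1) :
    cigarRho (Matrix.vecTail (polarMap q)) = q 1 := by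
  have h : (Real.sinh (q 1) * Real.cos (q 2)) ^ 2 + (Real.sinh (q 1) * Real.sin (q 2)) ^ 2 =
      Real.sinh (q 1) ^ 2 := by
    linear_combination Real.sinh (q 1) ^ 2 * Real.sin_sq_add_cos_sq (q 2)
  simp [cigarRho, Matrix.vecTail, polarMap]
  -- The square root yields `|sinh ρ|`, which is `sinh ρ` only for `ρ ≥ 0`.
  rw [h, Real.sqrt_sq (Real.sinh_nonneg_iff.2 hq), Real.arsinh_sinh]

end RicciSoliton

theorem theorem3p4 :
    -- in the coordinates `(s, ρ, θ)` the metric of the product is `ds² + dρ² + tanh² ρ dθ²`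
    (∀ q v w : Fin 3 → ℝ,
      RicciSoliton.metricInner (RicciSoliton.lineProduct RicciSoliton.cigarMetric)
          (RicciSoliton.polarMap q)
          (fderiv ℝ RicciSoliton.polarMap q v) (fderiv ℝ RicciSoliton.polarMap q w) =
        v 0 * w 0 + v 1 * w 1 + Real.tanh (q 1) ^ 2 * (v 2 * w 2)) ∧
    (∀ q : Fin 3 → ℝ, 0 ≤ q 1 →
      RicciSoliton.cigarRho (Matrix.vecTail (RicciSoliton.polarMap q)) = q 1) ∧
    -- the Ricci potentials with linear growth
    {f : (Fin 3 → ℝ) → ℝ |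
        RicciSoliton.IsRicciPotential (RicciSoliton.lineProduct RicciSoliton.cigarMetric) f ∧
        RicciSoliton.HasLinearGrowth (RicciSoliton.lineProduct RicciSoliton.cigarMetric) f} =
      {f : (Fin 3 → ℝ) → ℝ | ∃ c₁ c₂ : ℝ, f = fun p =>
        c₁ + c₂ * p 0 +
          2 * Real.log (Real.cosh (RicciSoliton.cigarRho (Matrix.vecTail p)))} ∧
    -- `2 ln cosh ρ` is a Ricci potential of the cigar
    RicciSoliton.IsRicciPotential RicciSoliton.cigarMetric
      (fun p => 2 * Real.log (Real.cosh (RicciSoliton.cigarRho p))) := by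
  have h2 : (fun p => 2 * Real.log (Real.cosh (RicciSoliton.cigarRho p))) =
      fun p => Real.log (RicciSoliton.warp ![1, 1] p) := by
    funext p
    rw [RicciSoliton.two_mul_log_cosh_cigarRho]
    simp [RicciSoliton.warp, Fin.sum_univ_two, add_assoc]
  have h3 : ∀ p : Fin 3 → ℝ,
      2 * Real.log (Real.cosh (RicciSoliton.cigarRho (Matrix.vecTail p))) =
        Real.log (RicciSoliton.warp ![0, 1, 1] p) := by
    intro p
    rw [RicciSoliton.two_mul_log_cosh_cigarRho]
    simp [RicciSoliton.warp, Fin.sum_univ_three, Matrix.vecTail, add_assoc]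
  refine ⟨RicciSoliton.metricInner_polarMap, RicciSoliton.cigarRho_vecTail_polarMap, ?_, ?_⟩
  · ext f
    simp only [Set.mem_ofPred_eq, h3, RicciSoliton.lineProduct_cigarMetric_eq,
      RicciSoliton.isRicciPotential_iff]
    refine ⟨fun h => h.1, ?_⟩
    rintro ⟨c₁, c₂, rfl⟩
    exact ⟨⟨c₁, c₂, rfl⟩, RicciSoliton.hasLinearGrowth_affine_add_log_warp c₁ c₂⟩
  · rw [h2, RicciSoliton.cigarMetric_eq]
    exact RicciSoliton.isRicciPotential_log_warp_two
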